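/- Call a topological space $X$ locally simply connected if for every point $x\in X$ and every open neighbourhood $U$ of $x$ there is an open neighbourhood $V\subseteq U$ of $x$ such that every loop in $V$ is null-homotopic, relative to its end points, by a homotopy in $U$; call $X$ locally 1-connected if it is locally path connected and locally simply connected. Let $X$ be a connected, locally 1-connected metric space, let $A_1,\dots,A_n$ be pairwise disjoint compact, connected, locally path connected subsets of $X$ (connected spaces and sets being non-empty), and let $X/(A_1,\dots,A_n)$ be the quotient space, with the quotient topology, obtained from $X$ by identifying each of the sets $A_i$ to a point. Let $a\in X$ and $*\in X/(A_1,\dots,A_n)$ be any base points. If $\pi_1(X,a)$ is finitely generated, then so is $\pi_1(X/(A_1,\dots,A_n),*)$. -/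

import Mathlib

open Set Topology

/-- `X` is *locally simply connected*: every open neighbourhood `U` of a point contains an open
neighbourhood `V` of that point which is simply connected in `U`, that is, every loop in `V` is
null-homotopic, relative to its end points, by a homotopy in `U`. -/
def LocallySimplyConnected (X : Type*) [TopologicalSpace X] : Prop :=
  ∀ (x : X) (U : Set X), IsOpen U → x ∈ U →
    ∃ V : Set X, IsOpen V ∧ x ∈ V ∧ V ⊆ U ∧
      ∀ (y : X) (γ : Path y y), range γ ⊆ V →
        ∃ H : Path.Homotopy γ (Path.refl y), range H ⊆ U

/-- `X` is *locally 1-connected*: locally path connected and locally simply connected. -/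
def LocallyOneConnected (X : Type*) [TopologicalSpace X] : Prop :=
  LocallyPathConnectedSpace X ∧ LocallySimplyConnected X

/-- The equivalence relation on `X` that identifies each member of a family of pairwise disjoint
subsets `A i` to a point: `x ∼ y` iff `x = y` or `x` and `y` lie in a common `A i`. -/
def collapseSetoid {X ι : Type*} (A : ι → Set X)
    (hA : Pairwise fun i j => Disjoint (A i) (A j)) : Setoid X where
  r x y := x = y ∨ ∃ i, x ∈ A i ∧ y ∈ A i
  iseqv := by
    refine ⟨fun x => Or.inl rfl, ?_, ?_⟩
    · rintro x y (h | ⟨i, hx, hy⟩)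
      · exact Or.inl h.symm
      · exact Or.inr ⟨i, hy, hx⟩
    · rintro x y z (rfl | ⟨i, hx, hy⟩) (rfl | ⟨j, hy', hz⟩)
      · exact Or.inl rfl
      · exact Or.inr ⟨j, hy', hz⟩
      · exact Or.inr ⟨i, hx, hy⟩
      · have hij : i = j := by
          by_contra h
          exact Set.disjoint_left.mp (hA h) hy hy'
        subst hij
        exact Or.inr ⟨i, hx, hz⟩

/-- The space `X/(A₁, …, Aₙ)` obtained from `X` by collapsing each of the pairwise disjoint sets
`A i` to a point; as a `Quotient` it carries the quotient topology. -/
abbrev CollapsedSpace {X ι : Type*} (A : ι → Set X)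
    (hA : Pairwise fun i j => Disjoint (A i) (A j)) : Type _ :=
  Quotient (collapseSetoid A hA)

/-! The projection `q` of `X` onto the quotient induces a surjection of fundamental groups, and
finite generation passes to images. Surjectivity follows once every path in the quotient is
homotopic, rel end points, to the image of a path with prescribed end points over the given ones. By
subdivision this is a local question (`LiftsUpToHomotopy.of_local`). Away from the collapsed sets
`q` is injective and open, so paths lift exactly.

Near a collapsed set `A`, join the prescribed end points to `A` by short paths and connect these
inside `A`. The image of the result is homotopic to the given path because loops near the point
`q(A)` and based there are null-homotopic (`exists_loops_homotopic_refl_of_collapse`). This is the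
heart of the proof. Such a loop may meet `q(A)` in an arbitrary closed set of times. On the open
complement it lifts to `X \ A`, but the lift need not converge at the ends of an excursion; only its
distance to `A` tends to 0. The excursions are therefore cut, as in a Whitney decomposition, into
arcs whose size is bounded by their distance to `A`. Each arc is pushed into `A` across a small
square, filled by local simple connectivity of `X` and local path connectedness of `A`; adjacent
squares share a side. The squares shrink as the arcs approach `A`, so the deformation, composed with
`q`, extends continuously by the constant `q(A)`. -/

open scoped unitInterval

/-! ### Whitney decomposition on the line -/

/-- Nested dyadic intervals: if two dyadic intervals overlap, the finer one lies in the coarser. -/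
theorem dyadic_nested {n n' : ℕ} (h : n ≤ n') {m m' : ℤ} {t : ℝ}
    (h1 : (m : ℝ) / 2 ^ n ≤ t) (h2 : t < ((m : ℝ) + 1) / 2 ^ n)
    (h3 : (m' : ℝ) / 2 ^ n' ≤ t) (h4 : t < ((m' : ℝ) + 1) / 2 ^ n') :
    (m : ℝ) / 2 ^ n ≤ (m' : ℝ) / 2 ^ n' ∧ ((m' : ℝ) + 1) / 2 ^ n' ≤ ((m : ℝ) + 1) / 2 ^ n := by
  obtain ⟨k, rfl⟩ := Nat.exists_eq_add_of_le h
  have hn : (0 : ℝ) < 2 ^ n := by positivity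
  have hk : (0 : ℝ) < 2 ^ k := by positivity
  have e1 : (m : ℝ) / 2 ^ n = (m * 2 ^ k : ℝ) / 2 ^ (n + k) := by
    rw [pow_add]; field_simp
  have e2 : ((m : ℝ) + 1) / 2 ^ n = ((m + 1) * 2 ^ k : ℝ) / 2 ^ (n + k) := by
    rw [pow_add]; field_simp
  have hnk : (0 : ℝ) < 2 ^ (n + k) := by positivity
  rw [e1] at h1 ⊢
  rw [e2] at h2 ⊢
  rw [div_le_div_iff_of_pos_right hnk, div_le_div_iff_of_pos_right hnk]
  have a1 := (div_lt_div_iff_of_pos_right hnk).mp (h1.trans_lt h4)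
  have a2 := (div_lt_div_iff_of_pos_right hnk).mp (h3.trans_lt h2)
  have b1 : m * 2 ^ k < m' + 1 := by exact_mod_cast a1
  have b2 : m' < (m + 1) * 2 ^ k := by exact_mod_cast a2
  have c1 : m * 2 ^ k ≤ m' := by lia
  have c2 : m' + 1 ≤ (m + 1) * 2 ^ k := by lia
  exact ⟨by exact_mod_cast c1, by exact_mod_cast c2⟩

/-- Whitney decomposition of an open subset of the line: if small intervals around the points of
`O` are good, then there is a family of pairwise
non-overlapping good intervals which covers both sides of each point of `O`. -/
theorem exists_nonoverlapping_good_cover {O : Set ℝ} {Good : ℝ → ℝ → Prop}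
    (loc : ∀ t ∈ O, ∃ ε > 0, ∀ a b, t - ε < a → a < b → b < t + ε → Good a b) :
    ∃ F : Set (ℝ × ℝ), (∀ p ∈ F, p.1 < p.2 ∧ Good p.1 p.2) ∧
      (∀ t ∈ O, ∃ p ∈ F, p.1 ≤ t ∧ t < p.2) ∧ (∀ t ∈ O, ∃ p ∈ F, p.1 < t ∧ t ≤ p.2) ∧
      ∀ p ∈ F, ∀ p' ∈ F, ∀ t, p.1 ≤ t → t < p.2 → p'.1 ≤ t → t < p'.2 → p = p' := by
  classical
  set lo : ℕ → ℤ → ℝ := fun n m => (m : ℝ) / 2 ^ n with hlo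
  set hi : ℕ → ℤ → ℝ := fun n m => ((m : ℝ) + 1) / 2 ^ n with hhi
  have lohi : ∀ n m, lo n m < hi n m := fun n m => by
    simp only [hlo, hhi]; gcongr; linarith
  have gap : ∀ n m, hi n m = lo n m + (1 / 2) ^ n := fun n m => by
    simp only [hlo, hhi]; rw [one_div, inv_pow]; field_simp
  have small : ∀ t ∈ O, ∃ n, ∀ m, lo n m ≤ t → t ≤ hi n m → Good (lo n m) (hi n m) := by
    intro t ht
    obtain ⟨ε, hε, h⟩ := loc t ht
    obtain ⟨n, hn⟩ := exists_pow_lt_of_lt_one hε (by norm_num : (1 / 2 : ℝ) < 1)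
    refine ⟨n, fun m h1 h2 => h _ _ ?_ (lohi n m) ?_⟩ <;> have := gap n m <;> linarith
  -- The maximal good dyadic intervals: of two overlapping ones the finer lies in the coarser, so
  -- maximality forces them to coincide.
  refine ⟨{p | ∃ n m, p = (lo n m, hi n m) ∧ Good (lo n m) (hi n m) ∧ ∀ n' < n, ∀ m',
    lo n' m' ≤ lo n m → hi n m ≤ hi n' m' → ¬ Good (lo n' m') (hi n' m')}, ?_, ?_, ?_, ?_⟩
  · rintro p ⟨n, m, rfl, h, -⟩
    exact ⟨lohi n m, h⟩
  · intro t ht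
    have ex : ∃ n, ∃ m, lo n m ≤ t ∧ t < hi n m ∧ Good (lo n m) (hi n m) := by
      obtain ⟨n, hn⟩ := small t ht
      have h1 : lo n ⌊t * 2 ^ n⌋ ≤ t := by
        simp only [hlo]; rw [div_le_iff₀ (by positivity)]; exact Int.floor_le _
      have h2 : t < hi n ⌊t * 2 ^ n⌋ := by
        simp only [hhi]; rw [lt_div_iff₀ (by positivity)]; exact Int.lt_floor_add_one _
      exact ⟨n, _, h1, h2, hn _ h1 h2.le⟩
    obtain ⟨m, h1, h2, h3⟩ := Nat.find_spec ex
    refine ⟨_, ⟨_, m, rfl, h3, fun n' hn' m' h4 h5 h6 => Nat.find_min ex hn'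
      ⟨m', h4.trans h1, h2.trans_le h5, h6⟩⟩, h1, h2⟩
  · intro t ht
    have ex : ∃ n, ∃ m, lo n m < t ∧ t ≤ hi n m ∧ Good (lo n m) (hi n m) := by
      obtain ⟨n, hn⟩ := small t ht
      have h1 : lo n (⌈t * 2 ^ n⌉ - 1) < t := by
        simp only [hlo]; rw [div_lt_iff₀ (by positivity)]; push_cast
        linarith [Int.ceil_lt_add_one (t * 2 ^ n)]
      have h2 : t ≤ hi n (⌈t * 2 ^ n⌉ - 1) := by
        simp only [hhi]; rw [le_div_iff₀ (by positivity)]; push_cast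
        linarith [Int.le_ceil (t * 2 ^ n)]
      exact ⟨n, _, h1, h2, hn _ h1.le h2⟩
    obtain ⟨m, h1, h2, h3⟩ := Nat.find_spec ex
    refine ⟨_, ⟨_, m, rfl, h3, fun n' hn' m' h4 h5 h6 => Nat.find_min ex hn'
      ⟨m', h4.trans_lt h1, h2.trans h5, h6⟩⟩, h1, h2⟩
  · rintro _ ⟨n, m, rfl, hg, hm⟩ _ ⟨n', m', rfl, hg', hm'⟩ t h1 h2 h3 h4
    rcases lt_trichotomy n n' with h | rfl | h
    · obtain ⟨a, b⟩ := dyadic_nested h.le h1 h2 h3 h4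
      exact absurd hg (hm' n h m a b)
    · obtain ⟨a, b⟩ := dyadic_nested le_rfl h1 h2 h3 h4
      obtain ⟨c, d⟩ := dyadic_nested le_rfl h3 h4 h1 h2
      exact Prod.ext (le_antisymm a c) (le_antisymm d b)
    · obtain ⟨a, b⟩ := dyadic_nested h.le h3 h4 h1 h2
      exact absurd hg' (hm n' h m' a b)

/-! ### Controlled choices and small squares -/

/-- If for every `ε` all sufficiently small indices have an object of size at most `ε`, then
objects can be chosen whose sizes tend to zero with the size of the index. -/
theorem exists_choice_of_small {ι α : Type*} [Nonempty α] {s : ι → ℝ} (hs : ∀ i, 0 < s i)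
    {Q : ι → α → ℝ → Prop} (mono : ∀ {i g ε ε'}, ε ≤ ε' → Q i g ε → Q i g ε')
    (h : ∀ ε > 0, ∃ η > 0, ∀ i, s i < η → ∃ g, Q i g ε) :
    ∃ g : ι → α, (∀ i, ∀ ε > 0, (∃ g', Q i g' ε) → ∃ ε', Q i (g i) ε') ∧
      ∀ ε > 0, ∃ η > 0, ∀ i, s i < η → Q i (g i) ε := by
  -- The least size need not be attained, so `g` is chosen within `s i` of the infimum. This error
  -- vanishes with the size of the index.
  have key : ∀ i, ∃ g, ∀ ε > 0, (∃ g', Q i g' ε) → Q i g (ε + s i) := by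
    intro i
    by_cases hne : ∃ ε > 0, ∃ g, Q i g ε
    · set E := {ε : ℝ | 0 < ε ∧ ∃ g, Q i g ε}
      have hE : E.Nonempty := by obtain ⟨ε, a, b⟩ := hne; exact ⟨ε, a, b⟩
      obtain ⟨ε, ⟨-, g, hg⟩, hlt⟩ := exists_lt_of_csInf_lt hE (lt_add_of_pos_right (sInf E) (hs i))
      refine ⟨g, fun ε' h' hg' => mono ?_ hg⟩
      have : sInf E ≤ ε' := csInf_le ⟨0, fun x hx => hx.1.le⟩ ⟨h', hg'⟩
      linarith
    · exact ⟨Classical.arbitrary α, fun ε h' hg' => absurd ⟨ε, h', hg'⟩ hne⟩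
  choose g hg using key
  refine ⟨g, fun i ε hε h' => ⟨_, hg i ε hε h'⟩, fun ε hε => ?_⟩
  obtain ⟨η, hη, h'⟩ := h (ε / 2) (half_pos hε)
  refine ⟨min η (ε / 2), by positivity, fun i hi => mono ?_ (hg i (ε / 2) (half_pos hε)
    (h' i (hi.trans_le (min_le_left _ _))))⟩
  linarith [hi.trans_le (min_le_right _ _)]

/-- The square with bottom `f` and vertical sides `c`, `c'` (preceded by a pause) can be filled, with
the top in the image of `α`, if the loop `f * c' * α⁻¹ * c⁻¹` is null-homotopic. -/
theorem exists_square_of_homotopic_refl {Z : Type*} [TopologicalSpace Z] {x x' y y' : Z}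
    (f : Path x x') (c : Path x y) (c' : Path x' y') (α : Path y y')
    (h : (f.trans (c'.trans (α.symm.trans c.symm))).Homotopic (Path.refl x)) :
    ∃ g : C(I × I, Z), (∀ t, g (t, 0) = f t) ∧ (∀ t, g (t, 1) ∈ range α) ∧
      (∀ u, g (0, u) = (Path.refl x).trans c u) ∧ ∀ u, g (1, u) = (Path.refl x').trans c' u := by
  have hK : f.Homotopic (c.trans (α.trans c'.symm)) := by
    open Path.Homotopic.Quotient in
    rw [← eq] at h ⊢
    simp only [mk_trans, mk_symm, mk_refl] at h ⊢
    have := congrArg (fun z => z.trans ((mk c).trans ((mk α).trans (mk c').symm))) h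
    simp only [trans_assoc, refl_trans] at this
    rw [← this, ← trans_assoc (symm (mk c)), symm_trans, refl_trans, ← trans_assoc (symm (mk α)),
      symm_trans, refl_trans, trans_symm, trans_refl]
  obtain ⟨K⟩ := hK
  -- `P u` follows the rest of `c` from `c u`, then `α`, then `c'` backwards to `c' u`. It shrinks
  -- `c * α * c'⁻¹` to `α` with end points moving along `c` and `c'`. The homotopy `K` performed
  -- before it fixes the end points, whence the pause.
  let p : ∀ u : I, Path (c u) y := fun u => (c.subpath u 1).cast rfl c.target.symm
  let p' : ∀ u : I, Path y' (c' u) := fun u => ((c'.subpath u 1).cast rfl c'.target.symm).symm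
  have hp : Continuous ↿p :=
    c.subpath_continuous_family.comp (continuous_fst.prodMk (continuous_const.prodMk continuous_snd))
  have hp' : Continuous ↿p' := Path.symm_continuous_family _ <|
    c'.subpath_continuous_family.comp (continuous_fst.prodMk (continuous_const.prodMk continuous_snd))
  let P : ∀ u : I, Path (c u) (c' u) := fun u => (p u).trans (α.trans (p' u))
  have hP : Continuous ↿P := Path.trans_continuous_family _ hp _
    (Path.trans_continuous_family _ (α.continuous.comp continuous_snd) _ hp')
  have hP0 : ∀ t, P 0 t = c.trans (α.trans c'.symm) t := by
    intro t
    have h1 : ∀ s, p 0 s = c s := fun s => by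
      simp [p]
    have h2 : ∀ s, p' 0 s = c'.symm s := fun s => by
      simp [p']
    simp [P, Path.trans_apply, h1, h2]
  have hP1 : ∀ t, P 1 t ∈ range α := by
    intro t
    have : range (P 1) ⊆ range α := by
      simp [P, p, p', Path.trans_range]
    exact this (mem_range_self t)
  let L : ContinuousMap.Homotopy (c.trans (α.trans c'.symm)).toContinuousMap
      (P 1).toContinuousMap :=
    { toFun := fun z => P z.1 z.2
      continuous_toFun := hP
      map_zero_left := hP0
      map_one_left := fun t => rfl }
  let G := K.toHomotopy.trans L
  refine ⟨⟨fun z => G (z.2, z.1), by fun_prop⟩, fun t => ?_, fun t => ?_, fun u => ?_, fun u => ?_⟩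
  · simp
  · simpa using hP1 t
  · simp only [ContinuousMap.coe_mk, G, ContinuousMap.Homotopy.trans_apply, Path.trans_apply]
    split_ifs
    · exact K.source _
    · exact (P _).source
  · simp only [ContinuousMap.coe_mk, G, ContinuousMap.Homotopy.trans_apply, Path.trans_apply]
    split_ifs
    · exact K.target _
    · exact (P _).target

/-- A path whose image lies in `U`, as a path in the subspace `U`. -/
def Path.restrictRange {X : Type*} [TopologicalSpace X] {x y : X} (γ : Path x y) {U : Set X}
    (h : range γ ⊆ U) : Path (⟨x, h γ.source_mem_range⟩ : U) ⟨y, h γ.target_mem_range⟩ where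
  toFun t := ⟨γ t, h (mem_range_self t)⟩
  continuous_toFun := by fun_prop
  source' := Subtype.ext γ.source
  target' := Subtype.ext γ.target

/-- Points near a compact subset of a locally path connected space are joined to it by short
paths. -/
theorem exists_short_path_to_compact {X : Type*} [MetricSpace X] [LocallyPathConnectedSpace X]
    {A : Set X} (hA : IsCompact A) (hne : A.Nonempty) {ε : ℝ} (hε : 0 < ε) :
    ∃ η > 0, ∀ x, Metric.infDist x A < η →
      ∃ y ∈ A, ∃ c : Path x y, range c ⊆ Metric.ball x ε := by
  have h : ∀ a : X, ∃ N ∈ 𝓝 a, IsPathConnected N ∧ N ⊆ Metric.ball a (ε / 2) := by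
    intro a
    obtain ⟨N, ⟨h1, h2⟩, h3⟩ := (LocallyPathConnectedSpace.path_connected_basis a).mem_iff.mp
      (Metric.ball_mem_nhds a (half_pos hε))
    exact ⟨N, h1, h2, h3⟩
  choose N hN hNp hNb using h
  obtain ⟨η, hη, hsub⟩ := hA.exists_thickening_subset_open (t := ⋃ a : A, interior (N a))
    (isOpen_iUnion fun a => isOpen_interior)
    (fun a ha => mem_iUnion.mpr ⟨⟨a, ha⟩, mem_interior_iff_mem_nhds.mpr (hN a)⟩)
  refine ⟨η, hη, fun x hx => ?_⟩
  have hx' : x ∈ Metric.thickening η A := by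
    obtain ⟨y, hy, hxy⟩ := (Metric.infDist_lt_iff hne).mp hx
    exact Metric.mem_thickening_iff.mpr ⟨y, hy, hxy⟩
  obtain ⟨⟨a, ha⟩, hxa⟩ := mem_iUnion.mp (hsub hx')
  have hxN : x ∈ N a := interior_subset hxa
  obtain ⟨c, hc⟩ := (hNp a).joinedIn x hxN a (mem_of_mem_nhds (hN a))
  refine ⟨a, ha, c, ?_⟩
  rintro _ ⟨t, rfl⟩
  have h1 := hNb a (hc t)
  have h2 := hNb a hxN
  rw [Metric.mem_ball] at h1 h2 ⊢
  linarith [dist_triangle_right (c t) x a]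

/-- Near a compact, locally path connected subset `A` of a locally simply connected space, small
squares with vertical sides ending in `A` can be filled by small squares with top side in `A`. -/
theorem exists_small_square {X : Type*} [MetricSpace X] (hX : LocallySimplyConnected X)
    {A : Set X} (hA : IsCompact A) (hloc : LocallyPathConnectedSpace A) {ε : ℝ} (hε : 0 < ε) :
    ∃ η > 0, ∀ p ∈ A, ∀ (x x' y y' : X) (f : Path x x') (c : Path x y) (c' : Path x' y'),
      y ∈ A → y' ∈ A → range f ⊆ Metric.ball p η → range c ⊆ Metric.ball p η →
      range c' ⊆ Metric.ball p η →
      ∃ g : C(I × I, X), (∀ t, g (t, 0) = f t) ∧ (∀ t, g (t, 1) ∈ A) ∧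
        (∀ u, g (0, u) = (Path.refl x).trans c u) ∧
        (∀ u, g (1, u) = (Path.refl x').trans c' u) ∧ ∀ z, g z ∈ Metric.ball p ε := by
  -- Loops in `V` contract in a small ball; `O` is so small that points of `A ∩ O` are joined inside
  -- `A ∩ V`, which supplies the top side of the square.
  have h : ∀ a : A, ∃ V O : Set X, IsOpen V ∧ IsOpen O ∧ (a : X) ∈ V ∧ (a : X) ∈ O ∧
      V ⊆ Metric.ball (a : X) (ε / 2) ∧
      (∀ (y : X) (γ : Path y y), range γ ⊆ V →
        ∃ H : Path.Homotopy γ (Path.refl y), range H ⊆ Metric.ball (a : X) (ε / 2)) ∧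
      ∀ y ∈ A ∩ O, ∀ y' ∈ A ∩ O, JoinedIn (A ∩ V) y y' := by
    intro a
    obtain ⟨V, hV, haV, hVb, hVl⟩ := hX a (Metric.ball a (ε / 2)) Metric.isOpen_ball
      (Metric.mem_ball_self (half_pos hε))
    obtain ⟨N, ⟨h1, h2⟩, h3⟩ := (LocallyPathConnectedSpace.path_connected_basis a).mem_iff.mp
      ((hV.preimage continuous_subtype_val).mem_nhds haV)
    obtain ⟨O, hO, haO, hON⟩ := mem_nhds_subtype_iff_nhdsWithin.mp h1 |> mem_nhdsWithin.mp
    refine ⟨V, O, hV, hO, haV, haO, hVb, hVl, fun y hy y' hy' => ?_⟩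
    have hNA : ∀ z ∈ A ∩ O, ∃ h : z ∈ A, (⟨z, h⟩ : A) ∈ N := by
      intro z hz
      obtain ⟨w, hw, rfl⟩ := hON ⟨hz.2, hz.1⟩
      exact ⟨w.2, hw⟩
    obtain ⟨hyA, hyN⟩ := hNA y hy
    obtain ⟨hyA', hyN'⟩ := hNA y' hy'
    obtain ⟨α, hα⟩ := h2.joinedIn _ hyN _ hyN'
    exact ⟨α.map continuous_subtype_val, fun t => ⟨(α t).2, h3 (hα t)⟩⟩
  choose V O hV hO haV haO hVb hVl hj using h
  obtain ⟨η, hη, hcov⟩ := lebesgue_number_lemma_of_metric (c := fun a : A => V a ∩ O a) hA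
    (fun a => (hV a).inter (hO a)) (fun a ha => mem_iUnion.mpr ⟨⟨a, ha⟩, haV _, haO _⟩)
  refine ⟨η, hη, fun p hp x x' y y' f c c' hy hy' hf hc hc' => ?_⟩
  obtain ⟨a, ha⟩ := hcov p hp
  obtain ⟨α, hα⟩ := hj a y ⟨hy, (ha (hc c.target_mem_range)).2⟩ y'
    ⟨hy', (ha (hc' c'.target_mem_range)).2⟩
  have hVf : range f ⊆ V a := fun z hz => (ha (hf hz)).1
  have hVc : range c ⊆ V a := fun z hz => (ha (hc hz)).1
  have hVc' : range c' ⊆ V a := fun z hz => (ha (hc' hz)).1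
  have hVα : range α ⊆ V a := range_subset_iff.mpr fun t => (hα t).2
  -- Working in the ball as a space of its own makes the filling small automatically.
  let f₁ := f.restrictRange (hVf.trans (hVb a))
  let c₁ := c.restrictRange (hVc.trans (hVb a))
  let c₁' := c'.restrictRange (hVc'.trans (hVb a))
  let α₁ := α.restrictRange (hVα.trans (hVb a))
  let γ := f₁.trans (c₁'.trans (α₁.symm.trans c₁.symm))
  obtain ⟨H, hH⟩ := hVl a x (γ.map continuous_subtype_val) <| by
    have hval : range (γ.map continuous_subtype_val) = Subtype.val '' range γ := by
      rw [← range_comp]; rfl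
    rw [hval]
    rintro _ ⟨w, hw, rfl⟩
    simp only [γ, Path.trans_range, Path.symm_range] at hw
    rcases hw with ⟨t, rfl⟩ | ⟨t, rfl⟩ | ⟨t, rfl⟩ | ⟨t, rfl⟩
    exacts [hVf (mem_range_self t), hVc' (mem_range_self t), hVα (mem_range_self t),
      hVc (mem_range_self t)]
  have hnull : γ.Homotopic (Path.refl _) := ⟨
    { toFun := fun z => ⟨H z, hH (mem_range_self z)⟩
      continuous_toFun := by fun_prop
      map_zero_left := fun t => Subtype.ext (H.map_zero_left t)
      map_one_left := fun t => Subtype.ext (H.map_one_left t)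
      prop' := fun t s hs => Subtype.ext (H.prop' t s hs) }⟩
  obtain ⟨g, g1, g2, g3, g4⟩ := exists_square_of_homotopic_refl f₁ c₁ c₁' α₁ hnull
  refine ⟨⟨fun z => g z, by fun_prop⟩, fun t => congrArg Subtype.val (g1 t), fun t => ?_,
    fun u => ?_, fun u => ?_, fun z => ?_⟩
  · obtain ⟨s, hs⟩ := g2 t
    change (g (t, 1)).1 ∈ A
    rw [← hs]
    exact (hα s).1
  · refine (congrArg Subtype.val (g3 u)).trans ?_
    simp only [Path.trans_apply]
    split_ifs <;> rfl
  · refine (congrArg Subtype.val (g4 u)).trans ?_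
    simp only [Path.trans_apply]
    split_ifs <;> rfl
  · have h1 := (g z).2
    have h2 := hVb a (ha (Metric.mem_ball_self hη)).1
    change (g z).1 ∈ _
    rw [Metric.mem_ball] at h1 h2 ⊢
    linarith [dist_triangle_right (g z).1 p a]

/-! ### Deforming arcs into a compact set -/

/-- Near a compact, locally path connected set `A`, there are tracks from points to `A` such that
each small arc `d : [a, b] → X` can be deformed into `A`, through points close to `A`, with the end
points following their tracks. -/
theorem exists_tracks_and_deformations {X : Type*} [MetricSpace X] [LocallyPathConnectedSpace X]
    (hX : LocallySimplyConnected X) {A : Set X} (hA : IsCompact A) (hne : A.Nonempty)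
    (hloc : LocallyPathConnectedSpace A) :
    ∃ tr : X → I → X, ∀ ε > 0, ∃ η > 0, ∀ (a b : ℝ) (d : ℝ → X), a < b →
      ContinuousOn d (Icc a b) → (∀ t ∈ Icc a b, d t ∉ A) →
      (∃ p ∈ A, ∀ t ∈ Icc a b, ∀ t' ∈ Icc a b, dist (d t') p < 2 * Metric.infDist (d t) A) →
      Metric.infDist (d a) A < η →
      ∃ g : C(ℝ × I, X), (∀ t ∈ Icc a b, g (t, 0) = d t) ∧ (∀ t, g (t, 1) ∈ A) ∧
        (∀ u, g (a, u) = tr (d a) u) ∧ (∀ u, g (b, u) = tr (d b) u) ∧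
        ∀ z, Metric.infDist (g z) A < ε := by
  have : Nonempty C(I, X) := ⟨.const _ hne.some⟩
  obtain ⟨c, -, hc⟩ := exists_choice_of_small (ι := {x : X // x ∉ A}) (α := C(I, X))
    (s := fun x => Metric.infDist x.1 A)
    (Q := fun x c ε => c 0 = x.1 ∧ c 1 ∈ A ∧ range c ⊆ Metric.ball x.1 ε)
    (fun x => (hA.isClosed.notMem_iff_infDist_pos hne).mp x.2)
    (fun hε h => ⟨h.1, h.2.1, h.2.2.trans (Metric.ball_subset_ball hε)⟩)
    (fun ε hε => by
      obtain ⟨η, hη, h⟩ := exists_short_path_to_compact hA hne hε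
      refine ⟨η, hη, fun x hx => ?_⟩
      obtain ⟨y, hy, c, hc⟩ := h x hx
      exact ⟨c.toContinuousMap, c.source, by simpa using hy, hc⟩)
  classical
  -- The track pauses on the first half to match the vertical sides of the squares. Its value on `A`
  -- is only a default.
  refine ⟨fun x u => if h : x ∈ A then x else if h' : (u : ℝ) ≤ 1 / 2 then x else
    c ⟨x, h⟩ ⟨2 * u - 1, unitInterval.two_mul_sub_one_mem_iff.2 ⟨(not_le.1 h').le, u.2.2⟩⟩,
    fun ε hε => ?_⟩
  obtain ⟨η, hη, hsq⟩ := exists_small_square hX hA hloc hε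
  obtain ⟨η', hη', hc'⟩ := hc (η / 2) (half_pos hη)
  -- The arc lies within `2 * infDist (d a) A` of `p`: the bound `η / 4` puts it in the ball of
  -- radius `η / 2`, leaving room for tracks of length scale `η / 2`, and `η' / 2` makes the track
  -- at `d b` short as well.
  refine ⟨min (η / 4) (η' / 2), by positivity, fun a b d hab hd hdA hp hda => ?_⟩
  obtain ⟨p, hpA, hp⟩ := hp
  have ha : a ∈ Icc a b := left_mem_Icc.mpr hab.le
  have hb : b ∈ Icc a b := right_mem_Icc.mpr hab.le
  have hda1 := hda.trans_le (min_le_left _ _)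
  have hda2 := hda.trans_le (min_le_right _ _)
  have hball : ∀ t ∈ Icc a b, dist (d t) p < η / 2 := fun t ht => by
    linarith [hp a ha t ht]
  have hdb : Metric.infDist (d b) A < η' :=
    (Metric.infDist_le_dist_of_mem hpA).trans_lt (by linarith [hp a ha b hb])
  obtain ⟨ca0, ca1, ca2⟩ := hc' ⟨d a, hdA a ha⟩ (by dsimp only; linarith)
  obtain ⟨cb0, cb1, cb2⟩ := hc' ⟨d b, hdA b hb⟩ hdb
  let ca : Path (d a) _ := ⟨c ⟨d a, hdA a ha⟩, ca0, rfl⟩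
  let cb : Path (d b) _ := ⟨c ⟨d b, hdA b hb⟩, cb0, rfl⟩
  have hmem : ∀ t : I, a + (b - a) * t ∈ Icc a b := fun t => by
    have h1 := mul_nonneg (sub_nonneg.mpr hab.le) t.2.1
    have h2 := mul_le_mul_of_nonneg_left t.2.2 (sub_nonneg.mpr hab.le)
    constructor <;> linarith
  let f : Path (d a) (d b) :=
    { toFun := fun t => d (a + (b - a) * t)
      continuous_toFun := hd.comp_continuous (by fun_prop) hmem
      source' := by simp
      target' := by simp }
  have near : ∀ {x : X}, dist x p < η / 2 → Metric.ball x (η / 2) ⊆ Metric.ball p η :=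
    fun h => Metric.ball_subset_ball' (by linarith)
  obtain ⟨g, g1, g2, g3, g4, g5⟩ := hsq p hpA _ _ _ _ f ca cb ca1 cb1
    (range_subset_iff.mpr fun t => by
      have := hball _ (hmem t)
      rw [Metric.mem_ball]
      exact this.trans (by linarith))
    (ca2.trans (near (hball a ha))) (cb2.trans (near (hball b hb)))
  let θ : ℝ → I := fun t => projIcc 0 1 zero_le_one ((t - a) / (b - a))
  have hθ : Continuous θ := continuous_projIcc.comp (by fun_prop)
  have hba : b - a ≠ 0 := (sub_pos.mpr hab).ne'
  have hθa : θ a = 0 := by simp [θ]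
  have hθb : θ b = 1 := by simp [θ, hba]
  have hfθ : ∀ t ∈ Icc a b, f (θ t) = d t := fun t ht => by
    have h : (t - a) / (b - a) ∈ Icc (0 : ℝ) 1 :=
      ⟨div_nonneg (sub_nonneg.mpr ht.1) (sub_nonneg.mpr hab.le),
        (div_le_one (sub_pos.mpr hab)).mpr (by linarith [ht.2])⟩
    change d (a + (b - a) * (θ t : ℝ)) = d t
    have : (θ t : ℝ) = (t - a) / (b - a) := congrArg Subtype.val (projIcc_of_mem zero_le_one h)
    rw [this]
    congr 1
    field_simp
    ring
  refine ⟨⟨fun z => g (θ z.1, z.2), by fun_prop⟩, fun t ht => ?_, fun t => g2 _, fun u => ?_,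
    fun u => ?_, fun z => ?_⟩
  · exact (g1 _).trans (hfθ t ht)
  · change g (θ a, u) = _
    rw [hθa, g3, Path.trans_apply]
    simp only [dif_neg (hdA a ha)]
    rfl
  · change g (θ b, u) = _
    rw [hθb, g4, Path.trans_apply]
    simp only [dif_neg (hdA b hb)]
    rfl
  · exact (Metric.infDist_le_dist_of_mem hpA).trans_lt (g5 _)

/-- A map from an open subset of the line to the complement of `A`, with values close to `A`, can
be deformed into `A` in such a way that points close to `A` remain close to `A`. -/
theorem exists_deformation_into_compact {X : Type*} [MetricSpace X] [LocallyPathConnectedSpace X]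
    (hX : LocallySimplyConnected X) {A : Set X} (hA : IsCompact A) (hne : A.Nonempty)
    (hloc : LocallyPathConnectedSpace A) :
    ∃ η₀ > 0, ∀ (O : Set ℝ) (d : ℝ → X), IsOpen O → ContinuousOn d O →
      (∀ t ∈ O, d t ∉ A ∧ Metric.infDist (d t) A < η₀) →
      ∃ G : ℝ × I → X, ContinuousOn G (O ×ˢ univ) ∧ (∀ t ∈ O, G (t, 0) = d t) ∧
        (∀ t ∈ O, G (t, 1) ∈ A) ∧
        ∀ ε > 0, ∃ η > 0, ∀ t ∈ O, Metric.infDist (d t) A < η →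
          ∀ u, Metric.infDist (G (t, u)) A < ε := by
  have : Nonempty C(ℝ × I, X) := ⟨.const _ hne.some⟩
  obtain ⟨tr, htr⟩ := exists_tracks_and_deformations hX hA hne hloc
  obtain ⟨η₀, hη₀, h1⟩ := htr 1 one_pos
  refine ⟨η₀, hη₀, fun O d hO hd hdA => ?_⟩
  obtain ⟨F, hF, hFr, hFl, hFd⟩ := exists_nonoverlapping_good_cover (O := O)
    (Good := fun a b => Icc a b ⊆ O ∧ ∃ p ∈ A, ∀ t ∈ Icc a b, ∀ t' ∈ Icc a b,
      dist (d t') p < 2 * Metric.infDist (d t) A) (fun t ht => by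
    obtain ⟨p, hpA, hp⟩ := hA.exists_infDist_eq_dist hne (d t)
    have hpos := (hA.isClosed.notMem_iff_infDist_pos hne).mp (hdA t ht).1
    -- With `D` the distance from `d t` to `A`, a variation below `D / 5` gives distances to `p`
    -- below `6D / 5`, while twice the distance to `A` exceeds `8D / 5`.
    obtain ⟨ε, hε, hsub⟩ := Metric.mem_nhds_iff.mp (Filter.inter_mem (hO.mem_nhds ht)
      ((hd.continuousAt (hO.mem_nhds ht)).preimage_mem_nhds
        (Metric.ball_mem_nhds (d t) (by linarith : 0 < Metric.infDist (d t) A / 5))))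
    refine ⟨ε, hε, fun a b h1 h2 h3 => ?_⟩
    have hmem : ∀ s ∈ Icc a b, s ∈ O ∧ dist (d s) (d t) < Metric.infDist (d t) A / 5 :=
      fun s hs => hsub (by
        rw [Real.ball_eq_Ioo]; exact ⟨by linarith [hs.1], by linarith [hs.2]⟩)
    refine ⟨fun s hs => (hmem s hs).1, p, hpA, fun s hs s' hs' => ?_⟩
    have e1 := (hmem s hs).2
    have e2 := (hmem s' hs').2
    have e3 := dist_triangle (d s') (d t) p
    have e4 := Metric.infDist_le_infDist_add_dist (s := A) (x := d t) (y := d s)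
    rw [dist_comm] at e4
    linarith)
  have hleft : ∀ p ∈ F, p.1 ∈ Icc p.1 p.2 := fun p hp => left_mem_Icc.mpr (hF p hp).1.le
  have hs : ∀ p ∈ F, ∀ t ∈ Icc p.1 p.2,
      Metric.infDist (d p.1) A < 2 * Metric.infDist (d t) A := by
    intro p hp t ht
    obtain ⟨x, hxA, hx⟩ := (hF p hp).2.2
    exact (Metric.infDist_le_dist_of_mem hxA).trans_lt (hx t ht _ (hleft p hp))
  have hFO : ∀ p ∈ F, Icc p.1 p.2 ⊆ O := fun p hp => (hF p hp).2.1
  obtain ⟨g, hg1, hg2⟩ := exists_choice_of_small (ι := F) (α := C(ℝ × I, X))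
    (s := fun p => Metric.infDist (d p.1.1) A)
    (Q := fun p g ε => ((∀ t ∈ Icc p.1.1 p.1.2, g (t, 0) = d t) ∧ (∀ t, g (t, 1) ∈ A) ∧
        (∀ u, g (p.1.1, u) = tr (d p.1.1) u) ∧ (∀ u, g (p.1.2, u) = tr (d p.1.2) u)) ∧
        ∀ z, Metric.infDist (g z) A < ε)
    (fun p => (hA.isClosed.notMem_iff_infDist_pos hne).mp
      (hdA _ (hFO _ p.2 (hleft _ p.2))).1)
    (fun hε h => ⟨h.1, fun z => (h.2 z).trans_le hε⟩)
    (fun ε hε => by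
      obtain ⟨η, hη, h⟩ := htr ε hε
      refine ⟨η, hη, fun p hp => ?_⟩
      obtain ⟨g, a1, a2, a3, a4, a5⟩ := h p.1.1 p.1.2 d (hF _ p.2).1 (hd.mono (hFO _ p.2))
        (fun t ht => (hdA t (hFO _ p.2 ht)).1) (hF _ p.2).2.2 hp
      exact ⟨g, ⟨a1, a2, a3, a4⟩, a5⟩)
  have hg : ∀ p : F, (∀ t ∈ Icc p.1.1 p.1.2, g p (t, 0) = d t) ∧ (∀ t, g p (t, 1) ∈ A) ∧
      (∀ u, g p (p.1.1, u) = tr (d p.1.1) u) ∧ (∀ u, g p (p.1.2, u) = tr (d p.1.2) u) := by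
    intro p
    -- The bound `η₀` guarantees a filling of size 1 over every interval, so the near-optimal choice
    -- is a genuine filling there too, not a default value.
    obtain ⟨g, a1, a2, a3, a4, a5⟩ := h1 p.1.1 p.1.2 d (hF _ p.2).1 (hd.mono (hFO _ p.2))
        (fun t ht => (hdA t (hFO _ p.2 ht)).1) (hF _ p.2).2.2
        (hdA _ (hFO _ p.2 (hleft _ p.2))).2
    obtain ⟨ε, h⟩ := hg1 p 1 one_pos ⟨g, ⟨a1, a2, a3, a4⟩, a5⟩
    exact h.1
  have hFr' : ∀ t : O, ∃ p : F, p.1.1 ≤ t ∧ t < p.1.2 := fun t =>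
    let ⟨p, hp, h⟩ := hFr t t.2
    ⟨⟨p, hp⟩, h⟩
  choose r hr using hFr'
  classical
  let G : ℝ × I → X := fun z => if h : z.1 ∈ O then g (r ⟨z.1, h⟩) z else d z.1
  have hG : ∀ p : F, ∀ t ∈ Icc p.1.1 p.1.2, ∀ u, G (t, u) = g p (t, u) := by
    intro p t ht u
    have htO := hFO p p.2 ht
    simp only [G, dif_pos htO]
    obtain ⟨h1, h2⟩ := hr ⟨t, htO⟩
    set p' := r ⟨t, htO⟩
    dsimp only at h1 h2
    rcases ht.2.lt_or_eq with h | h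
    · rw [Subtype.ext (hFd p p.2 p' p'.2 t ht.1 h h1 h2)]
    -- Here `t` is the right end of `p`. Either `p'` starts before `t` and overlaps `p`, which is
    -- impossible, or it starts at `t` and both fillings follow the track of `d t`.
    · rcases h1.lt_or_eq with h' | h'
      · have hlt := (hF p p.2).1
        have := hFd p p.2 p' p'.2 (max p.1.1 p'.1.1) (le_max_left _ _) (max_lt hlt (h ▸ h'))
          (le_max_right _ _) ((max_le ht.1 h1).trans_lt h2)
        rw [← Subtype.ext this, h] at h2
        exact absurd h2 (lt_irrefl _)
      · have e1 := (hg p).2.2.2 u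
        have e2 := (hg p').2.2.1 u
        rw [← h] at e1
        rw [h'] at e2
        rw [e1, e2]
  refine ⟨G, ?_, fun t ht => ?_, fun t ht => ?_, fun ε hε => ?_⟩
  · rintro ⟨t, u⟩ ⟨ht, -⟩
    obtain ⟨p, hp, hp1, hp2⟩ := hFr t ht
    obtain ⟨p', hp', hp1', hp2'⟩ := hFl t ht
    have hcont : ∀ q : F, ∀ s ⊆ Icc q.1.1 q.1.2, t ∈ s →
        ContinuousWithinAt G (s ×ˢ univ) (t, u) := fun q s hs hts =>
      (g q).continuous.continuousWithinAt.congr (fun z hz => hG q z.1 (hs hz.1) z.2)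
        (hG q t (hs hts) u)
    have h := (hcont ⟨p', hp'⟩ (Icc p'.1 t) (Icc_subset_Icc_right hp2') ⟨hp1'.le, le_rfl⟩).union
      (hcont ⟨p, hp⟩ (Icc t p.2) (Icc_subset_Icc_left hp1) ⟨le_rfl, hp2.le⟩)
    rw [← union_prod, Icc_union_Icc_eq_Icc hp1'.le hp2.le] at h
    exact (h.continuousAt (prod_mem_nhds (Icc_mem_nhds hp1' hp2) Filter.univ_mem)).continuousWithinAt
  · have h := hr ⟨t, ht⟩
    have ht' : t ∈ Icc _ _ := ⟨h.1, h.2.le⟩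
    rw [hG _ t ht', (hg _).1 t ht']
  · have h := hr ⟨t, ht⟩
    rw [hG _ t ⟨h.1, h.2.le⟩]
    exact (hg _).2.1 t
  · obtain ⟨η, hη, h⟩ := hg2 ε hε
    -- The index is measured at the left end of its interval, where the distance to `A` is less than
    -- twice that at `t`.
    refine ⟨η / 2, half_pos hη, fun t ht hlt u => ?_⟩
    have h' := hr ⟨t, ht⟩
    have ht' : t ∈ Icc _ _ := ⟨h'.1, h'.2.le⟩
    rw [hG _ t ht']
    exact (h _ (by linarith [hs _ (r ⟨t, ht⟩).2 t ht'])).2 _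

/-! ### Contracting loops near a collapsed set -/

/-- If `q` collapses `A` to a point and is an open embedding elsewhere near `A`, then the loops at
that point which stay close to it are null-homotopic. -/
theorem exists_loops_homotopic_refl_of_collapse {X Y : Type*} [MetricSpace X]
    [LocallyPathConnectedSpace X] [TopologicalSpace Y]
    (hX : LocallySimplyConnected X) {A : Set X} (hA : IsCompact A) (hne : A.Nonempty)
    (hloc : LocallyPathConnectedSpace A) {q : X → Y} (hq : Continuous q) {y : Y}
    (hy : ∀ x, q x = y ↔ x ∈ A) {ρ : ℝ} (hρ : 0 < ρ)
    (hinj : ∀ x x', Metric.infDist x A < ρ → x ∉ A → q x = q x' → x = x')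
    (hopen : ∀ U, IsOpen U → (∀ x ∈ U, Metric.infDist x A < ρ) → (A ⊆ U ∨ Disjoint A U) →
      IsOpen (q '' U)) :
    ∃ η > 0, ∀ δ : Path y y, range δ ⊆ q '' {x | Metric.infDist x A < η} →
      δ.Homotopic (Path.refl y) := by
  obtain ⟨η₀, hη₀, hdef⟩ := exists_deformation_into_compact hX hA hne hloc
  have hUo : ∀ r, IsOpen {x | Metric.infDist x A < r} := fun r =>
    isOpen_lt (Metric.continuous_infDist_pt A) continuous_const
  have hAU : ∀ {r}, 0 < r → A ⊆ {x | Metric.infDist x A < r} := fun hr x hx => by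
    simpa [Metric.infDist_zero_of_mem hx] using hr
  refine ⟨min η₀ ρ, by positivity, fun δ hδ => ?_⟩
  have hd : ∀ t : ℝ, ∃ x, Metric.infDist x A < min η₀ ρ ∧ q x = δ.extend t := fun t =>
    hδ (by rw [← δ.extend_range]; exact mem_range_self t)
  choose d hd1 hd2 using hd
  -- The pointwise lift `d` is unique, hence continuous, on `O`; elsewhere it is an arbitrary point
  -- of `A`.
  let O : Set ℝ := {t | d t ∉ A}
  have hOy : ∀ t, t ∈ O ↔ δ.extend t ≠ y := fun t => by
    rw [← hd2, ne_eq, hy]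
    rfl
  have hnbhd : ∀ t ∈ O, ∀ U : Set X, IsOpen U → d t ∈ U → ∀ᶠ s in 𝓝 t, s ∈ O ∧ d s ∈ U := by
    intro t ht U hU htU
    have ho := hopen (U ∩ {x | Metric.infDist x A < ρ} ∩ Aᶜ)
      ((hU.inter (hUo ρ)).inter hA.isClosed.isOpen_compl) (fun x hx => hx.1.2)
      (.inr (disjoint_compl_right.mono_right inter_subset_right))
    have hmem : δ.extend t ∈ q '' (U ∩ {x | Metric.infDist x A < ρ} ∩ Aᶜ) :=
      ⟨d t, ⟨⟨htU, (hd1 t).trans_le (min_le_right _ _)⟩, ht⟩, hd2 t⟩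
    filter_upwards [(ho.preimage δ.extend.continuous).mem_nhds hmem] with s hs
    obtain ⟨x, hx, hxs⟩ := hs
    have : x = d s := hinj _ _ hx.1.2 hx.2 (hxs.trans (hd2 s).symm)
    subst this
    exact ⟨hx.2, hx.1.1⟩
  have hO : IsOpen O := isOpen_iff_mem_nhds.mpr fun t ht =>
    (hnbhd t ht univ isOpen_univ trivial).mono fun s hs => hs.1
  have hdc : ContinuousOn d O := fun t ht => ContinuousAt.continuousWithinAt <| by
    refine tendsto_nhds.mpr fun U hU htU => ?_
    exact (hnbhd t ht U hU htU).mono fun s hs => hs.2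
  obtain ⟨G, hG, hG0, hG1, hGε⟩ := hdef O d hO hdc fun t ht =>
    ⟨ht, (hd1 t).trans_le (min_le_left _ _)⟩
  classical
  let H : ℝ × I → Y := fun z => if z.1 ∈ O then q (G z) else y
  have hHO : ∀ {t}, t ∈ O → ∀ u, H (t, u) = q (G (t, u)) := fun ht u => if_pos ht
  have hHc : ∀ {t}, t ∉ O → ∀ u, H (t, u) = y := fun ht u => if_neg ht
  have hH : Continuous H := by
    refine continuous_iff_continuousAt.mpr fun ⟨t, u⟩ => ?_
    by_cases ht : t ∈ O
    · have hn : O ×ˢ univ ∈ 𝓝 (t, u) := prod_mem_nhds (hO.mem_nhds ht) Filter.univ_mem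
      refine (hq.continuousAt.comp (hG.continuousAt hn)).congr ?_
      filter_upwards [hn] with z hz using (hHO hz.1 z.2).symm
    -- By compactness `q ⁻¹' N` contains a thickening of `A`. For times near `t` in `O` the lift is
    -- close to `A`, so its whole deformation stays in that thickening.
    · refine tendsto_nhds.mpr fun N hN hyN => ?_
      rw [hHc ht] at hyN
      obtain ⟨ε, hε, hεN⟩ := hA.exists_thickening_subset_open (hN.preimage hq)
        (fun x hx => by rwa [mem_preimage, (hy x).mpr hx])
      obtain ⟨η, hη, hη'⟩ := hGε ε hε
      have ho := hopen {x | Metric.infDist x A < min η ρ} (hUo _)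
        (fun x hx => hx.trans_le (min_le_right _ _)) (.inl (hAU (by positivity)))
      have hmem : δ.extend t ∈ q '' {x | Metric.infDist x A < min η ρ} := by
        have : d t ∈ A := not_not.mp ht
        exact ⟨d t, hAU (by positivity) this, hd2 t⟩
      filter_upwards [prod_mem_nhds ((ho.preimage δ.extend.continuous).mem_nhds hmem)
        Filter.univ_mem] with ⟨s, v⟩ hs
      by_cases hsO : s ∈ O
      · obtain ⟨x, hx, hxs⟩ := hs.1
        have : d s = x := hinj _ _ ((hd1 s).trans_le (min_le_right _ _)) hsO
          ((hd2 s).trans hxs.symm)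
        subst this
        rw [mem_preimage, hHO hsO]
        refine hεN ((Metric.mem_thickening_iff_infDist_lt hne).mpr ?_)
        exact hη' s hsO (hx.trans_le (min_le_left _ _)) v
      · rwa [mem_preimage, hHc hsO]
  have hH0 : ∀ t, H (t, 0) = δ.extend t := fun t => by
    by_cases ht : t ∈ O
    · rw [hHO ht, hG0 t ht, hd2]
    · rw [hHc ht]
      exact (not_not.mp (mt (hOy t).mpr ht)).symm
  have hH1 : ∀ t, H (t, 1) = y := fun t => by
    by_cases ht : t ∈ O
    · rw [hHO ht, hy]
      exact hG1 t ht
    · rw [hHc ht]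
  refine ⟨
    { toFun := fun z => H (z.2, z.1)
      continuous_toFun := by fun_prop
      map_zero_left := fun t => by simp [hH0]
      map_one_left := fun t => by simp [hH1]
      prop' := fun s t ht => ?_ }⟩
  have : (t : ℝ) ∉ O := by
    rw [hOy]
    rcases ht with rfl | rfl <;> simp
  exact (hHc this s).trans (by rcases ht with rfl | rfl <;> simp)

/-! ### Topology of the collapsed space -/

section Collapse

variable {X : Type*} {n : ℕ} {A : Fin n → Set X}
  {hA : Pairwise fun i j => Disjoint (A i) (A j)}

theorem collapse_mk_eq_iff {x x' : X} :
    (Quotient.mk (collapseSetoid A hA) x = Quotient.mk (collapseSetoid A hA) x') ↔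
      x = x' ∨ ∃ i, x ∈ A i ∧ x' ∈ A i :=
  Quotient.eq

theorem collapse_mk_eq_of_mem {i : Fin n} {x x' : X} (hx : x ∈ A i) (hx' : x' ∈ A i) :
    Quotient.mk (collapseSetoid A hA) x = Quotient.mk (collapseSetoid A hA) x' :=
  collapse_mk_eq_iff.mpr (.inr ⟨i, hx, hx'⟩)

/-- Such a `U` is saturated, so it is the full preimage of its image. -/
theorem isOpen_collapse_image [TopologicalSpace X] {U : Set X} (hU : IsOpen U)
    (h : ∀ i, A i ⊆ U ∨ Disjoint (A i) U) :
    IsOpen (Quotient.mk (collapseSetoid A hA) '' U) := by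
  rw [← isQuotientMap_quotient_mk'.isOpen_preimage]
  convert hU using 1
  refine Subset.antisymm (fun x hx => ?_) (fun x hx => ⟨x, hx, rfl⟩)
  obtain ⟨z, hz, hzx⟩ := hx
  rcases collapse_mk_eq_iff.mp hzx with rfl | ⟨i, h1, h2⟩
  · exact hz
  · rcases h i with h | h
    · exact h h2
    · exact absurd hz (disjoint_left.mp h h1)

end Collapse

/-! ### Lifting paths up to homotopy -/

/-- The path `δ` lifts through `q` up to homotopy, whatever lifts of its end points are given. -/
def LiftsUpToHomotopy {X Y : Type*} [TopologicalSpace X] [TopologicalSpace Y] (q : C(X, Y))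
    {y y' : Y} (δ : Path y y') : Prop :=
  ∀ (x x' : X) (hx : q x = y) (hx' : q x' = y'),
    ∃ γ : Path x x', (γ.map q.continuous).Homotopic (δ.cast hx hx')

namespace LiftsUpToHomotopy

variable {X Y : Type*} [TopologicalSpace X] [TopologicalSpace Y] {q : C(X, Y)}

theorem of_homotopic {y y' : Y} {δ δ' : Path y y'} (h : LiftsUpToHomotopy q δ)
    (hδ : δ.Homotopic δ') : LiftsUpToHomotopy q δ' := fun x x' hx hx' =>
  let ⟨γ, hγ⟩ := h x x' hx hx'
  ⟨γ, hγ.trans (hδ.pathCast hx hx')⟩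

/-- Since the end points may be lifted arbitrarily, any point over the junction serves as end of one
lift and start of the next. -/
theorem trans (hq : Function.Surjective q) {y y' y'' : Y} {δ : Path y y'} {δ' : Path y' y''}
    (h : LiftsUpToHomotopy q δ) (h' : LiftsUpToHomotopy q δ') :
    LiftsUpToHomotopy q (δ.trans δ') := by
  rintro x x'' rfl rfl
  obtain ⟨x', rfl⟩ := hq y'
  obtain ⟨γ, hγ⟩ := h x x' rfl rfl
  obtain ⟨γ', hγ'⟩ := h' x' x'' rfl rfl
  refine ⟨γ.trans γ', ?_⟩
  rw [Path.map_trans]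
  exact hγ.hcomp hγ'

/-- If the sufficiently small paths lift up to homotopy, then all paths do. -/
theorem of_local (hq : Function.Surjective q)
    (h : ∀ y : Y, ∃ W : Set Y, IsOpen W ∧ y ∈ W ∧
      ∀ (y₁ y₂ : Y) (δ : Path y₁ y₂), range δ ⊆ W → LiftsUpToHomotopy q δ)
    {y y' : Y} (δ : Path y y') : LiftsUpToHomotopy q δ := by
  choose W hWo hyW hW using h
  -- A Lebesgue subdivision, eventually equal to 1, puts each piece of `δ` in a good open set; the
  -- pieces are then concatenated one at a time.
  obtain ⟨t, ht0, htm, ⟨N, hN⟩, ht⟩ := exists_monotone_Icc_subset_open_cover_unitInterval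
    (c := fun y => δ ⁻¹' W y) (fun y => (hWo y).preimage δ.continuous)
    (fun s _ => mem_iUnion.mpr ⟨δ s, hyW _⟩)
  have key : ∀ k, LiftsUpToHomotopy q (δ.subpath (t 0) (t k)) := by
    intro k
    induction k with
    | zero =>
      rw [Path.subpath_self]
      exact hW _ _ _ _ (by simpa using hyW _)
    | succ k ih =>
      obtain ⟨z, hz⟩ := ht k
      refine (ih.trans hq (hW z _ _ (δ.subpath (t k) (t (k + 1))) ?_)).of_homotopic
        ⟨Path.Homotopy.subpathTransSubpath δ _ _ _⟩
      rw [Path.range_subpath_of_le _ _ _ (htm k.le_succ)]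
      exact image_subset_iff.mpr hz
  have h1 := key N
  rw [ht0, hN N le_rfl, Path.subpath_zero_one] at h1
  intro x x' hx hx'
  exact h1 x x' (hx.trans δ.source.symm) (hx'.trans δ.target.symm)

/-- If all loops lift up to homotopy, then the induced map of fundamental groups is surjective. -/
theorem surjective_map (h : ∀ {y y' : Y} (δ : Path y y'), LiftsUpToHomotopy q δ) (a : X) :
    Function.Surjective (FundamentalGroup.map q a) := by
  intro g
  obtain ⟨δ, rfl⟩ := Path.Homotopic.Quotient.mk_surjective (FundamentalGroup.toPath g)
  obtain ⟨γ, hγ⟩ := h δ a a rfl rfl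
  exact ⟨FundamentalGroup.fromPath (.mk γ), Path.Homotopic.Quotient.eq.mpr hγ⟩

end LiftsUpToHomotopy

/-! ### Lifting through the collapse map -/

section Lifting

variable {X : Type*} [MetricSpace X] {n : ℕ} {A : Fin n → Set X}
  {hA : Pairwise fun i j => Disjoint (A i) (A j)}

/-- The projection onto the collapsed space, as a bundled continuous map. -/
def collapseMap (A : Fin n → Set X) (hA : Pairwise fun i j => Disjoint (A i) (A j)) :
    C(X, CollapsedSpace A hA) :=
  ⟨Quotient.mk _, continuous_quotient_mk'⟩

/-- Away from the collapsed sets, paths in the collapsed space lift. -/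
theorem liftsUpToHomotopy_of_range_subset (hclosed : ∀ i, IsClosed (A i))
    {y y' : CollapsedSpace A hA} (δ : Path y y')
    (hδ : range δ ⊆ collapseMap A hA '' (⋃ i, A i)ᶜ) :
    LiftsUpToHomotopy (collapseMap A hA) δ := by
  intro x x' hx hx'
  have hinj : ∀ z ∉ ⋃ i, A i, ∀ z', collapseMap A hA z = collapseMap A hA z' → z = z' := by
    intro z hz z' h
    rcases collapse_mk_eq_iff.mp h with h | ⟨i, h, -⟩
    · exact h
    · exact absurd (mem_iUnion_of_mem i h) hz
  have hex : ∀ t, ∃ z ∉ ⋃ i, A i, collapseMap A hA z = δ t := fun t => hδ (mem_range_self t)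
  choose d hdA hd using hex
  have hc : Continuous d := by
    refine continuous_iff_continuousAt.mpr fun t => tendsto_nhds.mpr fun U hU htU => ?_
    have ho : IsOpen (collapseMap A hA '' (U ∩ (⋃ i, A i)ᶜ)) := by
      refine isOpen_collapse_image (hU.inter (isClosed_iUnion_of_finite hclosed).isOpen_compl)
        fun i => .inr ?_
      exact (disjoint_compl_right.mono_right inter_subset_right).mono_left (subset_iUnion A i)
    filter_upwards [(ho.preimage δ.continuous).mem_nhds ⟨d t, ⟨htU, hdA t⟩, hd t⟩] with s hs
    obtain ⟨z, hz, hzs⟩ := hs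
    rw [mem_preimage, ← hinj z hz.2 (d s) (hzs.trans (hd s).symm)]
    exact hz.1
  have h0 : d 0 = x := hinj _ (hdA 0) _ (by rw [hd, δ.source, hx])
  have h1 : d 1 = x' := hinj _ (hdA 1) _ (by rw [hd, δ.target, hx'])
  let γ : Path x x' := ⟨⟨d, hc⟩, h0, h1⟩
  have hγ : γ.map (collapseMap A hA).continuous = δ.cast hx hx' := Path.ext (funext hd)
  exact ⟨γ, hγ ▸ Path.Homotopic.refl _⟩

/-- Near the collapsed sets, paths in the collapsed space lift up to homotopy. -/
theorem exists_liftsUpToHomotopy_near (hX : LocallyOneConnected X)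
    (hcomp : ∀ i, IsCompact (A i)) (hconn : ∀ i, IsConnected (A i))
    (hloc : ∀ i, LocallyPathConnectedSpace (A i)) (i : Fin n) :
    ∃ W : Set (CollapsedSpace A hA), IsOpen W ∧ (∀ x ∈ A i, collapseMap A hA x ∈ W) ∧
      ∀ (y₁ y₂ : CollapsedSpace A hA) (δ : Path y₁ y₂), range δ ⊆ W →
        LiftsUpToHomotopy (collapseMap A hA) δ := by
  have := hX.1
  have hne := (hconn i).nonempty
  have hUo : ∀ r, IsOpen {x | Metric.infDist x (A i) < r} := fun r =>
    isOpen_lt (Metric.continuous_infDist_pt (A i)) continuous_const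
  have hAU : ∀ {r x}, 0 < r → x ∈ A i → Metric.infDist x (A i) < r := fun hr hx => by
    simpa [Metric.infDist_zero_of_mem hx] using hr
  -- The `ρ`-neighbourhood of `A i` misses the finitely many other collapsed sets, so only `A i` is
  -- identified there.
  obtain ⟨ρ, hρ, hρA⟩ : ∃ ρ > 0, ∀ x j, Metric.infDist x (A i) < ρ → x ∈ A j → j = i := by
    obtain ⟨ρ, hρ, h⟩ := (hcomp i).exists_thickening_subset_open
      (t := (⋃ j ∈ {j | j ≠ i}, A j)ᶜ)
      ((Set.toFinite _).isClosed_biUnion fun j _ => (hcomp j).isClosed).isOpen_compl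
      (fun x hx hx' => by
        obtain ⟨j, hj, hxj⟩ := mem_iUnion₂.mp hx'
        exact disjoint_left.mp (hA hj) hxj hx)
    refine ⟨ρ, hρ, fun x j hx hxj => ?_⟩
    by_contra hj
    exact h ((Metric.mem_thickening_iff_infDist_lt hne).mpr hx) (mem_iUnion₂.mpr ⟨j, hj, hxj⟩)
  have hopen : ∀ U, IsOpen U → (∀ x ∈ U, Metric.infDist x (A i) < ρ) →
      (A i ⊆ U ∨ Disjoint (A i) U) → IsOpen (collapseMap A hA '' U) := by
    refine fun U hU hUρ h => isOpen_collapse_image hU fun j => ?_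
    by_cases hj : j = i
    · rwa [hj]
    · exact .inr (disjoint_left.mpr fun x hx hxU => hj (hρA x j (hUρ x hxU) hx))
  obtain ⟨p₀, hp₀⟩ := hne
  have hstar : ∀ p ∈ A i, ∀ x, collapseMap A hA x = collapseMap A hA p ↔ x ∈ A i := by
    refine fun p hp x => ⟨fun h => ?_, fun h => collapse_mk_eq_of_mem h hp⟩
    rcases collapse_mk_eq_iff.mp h with rfl | ⟨j, h1, h2⟩
    · exact hp
    · rwa [← hρA p j (hAU hρ hp) h2]
  obtain ⟨η, hη, hnull⟩ := exists_loops_homotopic_refl_of_collapse hX.2 (hcomp i) ⟨p₀, hp₀⟩ (hloc i)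
    (collapseMap A hA).continuous (hstar p₀ hp₀) hρ
    (fun x x' hx hxA h => (collapse_mk_eq_iff.mp h).resolve_right fun ⟨j, h1, _⟩ =>
      hxA (hρA x j hx h1 ▸ h1)) hopen
  obtain ⟨η', hη', hshort⟩ := exists_short_path_to_compact (hcomp i) ⟨p₀, hp₀⟩ (half_pos hη)
  -- `η'` provides connecting paths of radius `η / 2`, and starting within `η / 2` of `A i` keeps
  -- them within `η`.
  set r := min (min η' (η / 2)) ρ
  have hr : 0 < r := by positivity
  refine ⟨collapseMap A hA '' {x | Metric.infDist x (A i) < r},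
    hopen _ (hUo r) (fun x hx => lt_of_lt_of_le hx (min_le_right _ _))
      (.inl fun x hx => hAU hr hx), fun x hx => ⟨x, hAU hr hx, rfl⟩, ?_⟩
  rintro _ _ δ hδ x x' rfl rfl
  have hend : ∀ z, collapseMap A hA z ∈ range δ →
      ∃ p ∈ A i, ∃ c : Path z p, range c ⊆ {x | Metric.infDist x (A i) < η} := by
    intro z hz
    have hzr : Metric.infDist z (A i) < r := by
      obtain ⟨w, hw, hwz⟩ := hδ hz
      rcases collapse_mk_eq_iff.mp hwz with rfl | ⟨j, h1, h2⟩
      · exact hw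
      · exact hAU hr (hρA w j (lt_of_lt_of_le hw (min_le_right _ _)) h1 ▸ h2)
    obtain ⟨p, hp, c, hc⟩ := hshort z
      (hzr.trans_le ((min_le_left _ _).trans (min_le_left _ _)))
    refine ⟨p, hp, c, fun w hw => ?_⟩
    have h1 := Metric.mem_ball.mp (hc hw)
    have h2 := Metric.infDist_le_infDist_add_dist (s := A i) (x := w) (y := z)
    have h3 := hzr.trans_le ((min_le_left _ _).trans (min_le_right _ _))
    change Metric.infDist w (A i) < η
    linarith
  obtain ⟨p, hp, c, hc⟩ := hend x δ.source_mem_range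
  obtain ⟨p', hp', c', hc'⟩ := hend x' δ.target_mem_range
  have : LocallyPathConnectedSpace (A i) := hloc i
  have : PathConnectedSpace (A i) :=
    pathConnectedSpace_iff_connectedSpace.mpr (isConnected_iff_connectedSpace.mp (hconn i))
  obtain ⟨α, hα⟩ := (isPathConnected_iff_pathConnectedSpace.mpr this).joinedIn p hp p' hp'
  have hnull' : ∀ y, collapseMap A hA p₀ = y → ∀ ℓ : Path y y,
      range ℓ ⊆ collapseMap A hA '' {x | Metric.infDist x (A i) < η} →
      ℓ.Homotopic (Path.refl y) := by
    rintro _ rfl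
    exact hnull
  have hq := (collapseMap A hA).continuous
  -- The lift ignores the course of `δ`: the loop formed by `δ` and the images of `c`, `c'`, `α` is
  -- null-homotopic, and cancelling gives the homotopy.
  refine ⟨c.trans (α.trans c'.symm), ?_⟩
  have h := hnull' (collapseMap A hA p) (collapse_mk_eq_of_mem hp₀ hp)
    ((c.map hq).symm.trans (δ.trans ((c'.map hq).trans (α.map hq).symm))) <| by
    simp only [Path.trans_range, Path.symm_range, union_subset_iff, range_subset_iff]
    refine ⟨fun t => ⟨c t, hc (mem_range_self t), rfl⟩, fun t => ?_,
      fun t => ⟨c' t, hc' (mem_range_self t), rfl⟩, fun t => ⟨α t, hAU hη (hα t), rfl⟩⟩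
    obtain ⟨w, hw, hwt⟩ := hδ (mem_range_self t)
    have h1 : r ≤ η / 2 := (min_le_left _ _).trans (min_le_right _ _)
    exact ⟨w, lt_of_lt_of_le hw (h1.trans (half_le_self hη.le)), hwt⟩
  rw [Path.map_trans, Path.map_trans, ← Path.map_symm, Path.cast_rfl_rfl]
  open Path.Homotopic.Quotient in
  rw [← eq] at h ⊢
  simp only [mk_trans, mk_symm, mk_refl] at h ⊢
  have e := congrArg (fun z => (mk (c.map hq)).trans (z.trans
    ((mk (α.map hq)).trans (mk (c'.map hq)).symm))) h
  simp only [trans_assoc, refl_trans] at e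
  rw [← trans_assoc (symm (mk (α.map hq))), symm_trans, refl_trans, trans_symm, trans_refl,
    ← trans_assoc (mk (c.map hq)), trans_symm, refl_trans] at e
  exact e.symm

end Lifting

theorem corollary5p2 {X : Type*} [MetricSpace X] [ConnectedSpace X]
    (hX : LocallyOneConnected X) {n : ℕ} (A : Fin n → Set X)
    (hdisj : Pairwise fun i j => Disjoint (A i) (A j))
    (hcomp : ∀ i, IsCompact (A i)) (hconn : ∀ i, IsConnected (A i))
    (hloc : ∀ i, LocallyPathConnectedSpace (A i))
    (a : X) (b : CollapsedSpace A hdisj)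
    (hfg : Group.FG (FundamentalGroup X a)) :
    Group.FG (FundamentalGroup (CollapsedSpace A hdisj) b) := by
  have := hX.1
  have : PathConnectedSpace X := pathConnectedSpace_iff_connectedSpace.mpr inferInstance
  have hlift : ∀ {y y' : CollapsedSpace A hdisj} (δ : Path y y'),
      LiftsUpToHomotopy (collapseMap A hdisj) δ := by
    refine LiftsUpToHomotopy.of_local Quotient.mk_surjective fun y => ?_
    obtain ⟨x, rfl⟩ := Quotient.mk_surjective y
    by_cases hx : x ∈ ⋃ i, A i
    · obtain ⟨i, hi⟩ := mem_iUnion.mp hx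
      obtain ⟨W, hW, hWA, h⟩ := exists_liftsUpToHomotopy_near hX hcomp hconn hloc i
      exact ⟨W, hW, hWA x hi, h⟩
    · have hclosed := fun i => (hcomp i).isClosed
      refine ⟨collapseMap A hdisj '' (⋃ i, A i)ᶜ, ?_, ⟨x, hx, rfl⟩, fun _ _ δ hδ =>
        liftsUpToHomotopy_of_range_subset hclosed δ hδ⟩
      exact isOpen_collapse_image (isClosed_iUnion_of_finite hclosed).isOpen_compl
        fun i => .inr (disjoint_compl_right.mono_left (subset_iUnion A i))
  have := Group.fg_of_surjective (LiftsUpToHomotopy.surjective_map hlift a)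
  -- The quotient is path connected as an image of `X`, which allows the passage from base point `q
  -- a` to `b`.
  exact Group.fg_of_surjective (f := (FundamentalGroup.fundamentalGroupMulEquivOfPathConnected
    (collapseMap A hdisj a) b).toMonoidHom) (MulEquiv.surjective _)
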